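/- All rings are commutative with identity. For integers $n,d\ge 0$, an $R$-module $M$ is called $n$-presented if there is an exact sequence $F_n\to F_{n-1}\to\cdots\to F_0\to M\to 0$ of $R$-modules in which every $F_i$ is a finitely generated free $R$-module. A ring $R$ is called $(n,d)$-perfect if every $n$-presented $R$-module of flat dimension at most $d$ has projective dimension at most $d$. Let $D$ be an integral domain with quotient field $K$, and let $n\ge 2$, $m\ge 0$ and $d\ge 0$ be integers. Put $S=K[X]/(X^n-X)$, let $\overline X$ be the class of $X$ in $S$, and let $I=\overline X K[\overline X]$ be the ideal of $S$ generated by $\overline X$, so that $S=K+I$. Let $R=D+I$, a subring of $S$. Then $R$ is an $(m,d)$-perfect ring if and only if $D$ is an $(m,d)$-perfect ring. -/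

import Mathlib

open Polynomial

universe u

/-- `M` is an `n`-presented `R`-module: there is an exact sequence
`F n ⟶ F (n - 1) ⟶ ⋯ ⟶ F 0 ⟶ M ⟶ 0` in which each `F i` is a finitely generated free module,
here `F i = (Fin (r i) → R)`. The maps `f i : F (i + 1) ⟶ F i` are only constrained for `i < n`. -/
def IsNPresented (n : ℕ) (R : Type u) [CommRing R] (M : Type u) [AddCommGroup M] [Module R M] :
    Prop :=
  ∃ (r : ℕ → ℕ) (f : ∀ i, (Fin (r (i + 1)) → R) →ₗ[R] (Fin (r i) → R))
    (ε : (Fin (r 0) → R) →ₗ[R] M),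
    Function.Surjective ε ∧ (0 < n → Function.Exact (f 0) ε) ∧
      ∀ i, i + 1 < n → Function.Exact (f (i + 1)) (f i)

/-- `M` has flat dimension at most `d` over `R`: there is an exact sequence
`⋯ ⟶ F 1 ⟶ F 0 ⟶ M ⟶ 0` of flat modules with `F i = 0` for all `i > d`. -/
def HasFlatDimensionLE (d : ℕ) (R : Type u) [CommRing R] (M : Type u) [AddCommGroup M]
    [Module R M] : Prop :=
  ∃ (F : ℕ → ModuleCat.{u} R) (f : ∀ i, F (i + 1) →ₗ[R] F i) (ε : F 0 →ₗ[R] M),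
    (∀ i, Module.Flat R (F i)) ∧ (∀ i, d < i → Subsingleton (F i)) ∧
      Function.Surjective ε ∧ Function.Exact (f 0) ε ∧
        ∀ i, Function.Exact (f (i + 1)) (f i)

/-- `R` is an `(n, d)`-perfect ring: every `n`-presented `R`-module of flat dimension at most `d`
has projective dimension at most `d`. (As `n`-presented modules are finitely generated, modules in
the universe of `R` represent all of them up to isomorphism.) -/
def IsNDPerfectRing (n d : ℕ) (R : Type u) [CommRing R] : Prop :=
  ∀ (M : Type u) [AddCommGroup M] [Module R M], IsNPresented n R M → HasFlatDimensionLE d R M →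
    CategoryTheory.HasProjectiveDimensionLE (ModuleCat.of R M) d

/-- The quotient ring `S = K[X] / (X ^ n - X)`. -/
abbrev QuotRing (n : ℕ) (K : Type u) [Field K] : Type u :=
  K[X] ⧸ Ideal.span {(X ^ n - X : K[X])}

/-- The ideal `I = X̄ K[X̄]` of `S = K[X] / (X ^ n - X)` generated by the class `X̄` of `X`. -/
noncomputable def idealX (n : ℕ) (K : Type u) [Field K] : Ideal (QuotRing n K) :=
  Ideal.span {Ideal.Quotient.mk (Ideal.span {(X ^ n - X : K[X])}) X}

/-- The canonical ring homomorphism `D → K → K[X] → S = K[X] / (X ^ n - X)`. -/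
noncomputable def baseMap (n : ℕ) (D K : Type u) [CommRing D] [Field K] [Algebra D K] : D →+* QuotRing n K :=
  (Ideal.Quotient.mk (Ideal.span {(X ^ n - X : K[X])})).comp (C.comp (algebraMap D K))

/-- The subring `R = D + I` of `S = K[X] / (X ^ n - X)`, where `I = X̄ K[X̄]`. -/
noncomputable def subringDI (n : ℕ) (D K : Type u) [CommRing D] [Field K] [Algebra D K] :
    Subring (QuotRing n K) where
  carrier := {s | ∃ a : D, ∃ i ∈ idealX n K, s = baseMap n D K a + i}
  mul_mem' := by
    rintro _ _ ⟨a, i, hi, rfl⟩ ⟨b, j, hj, rfl⟩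
    refine ⟨a * b, baseMap n D K a * j + i * baseMap n D K b + i * j, ?_, ?_⟩
    · exact add_mem (add_mem (Ideal.mul_mem_left _ _ hj) (Ideal.mul_mem_right _ _ hi))
        (Ideal.mul_mem_left _ _ hj)
    · rw [map_mul]; ring
  one_mem' := ⟨1, 0, zero_mem _, by simp⟩
  add_mem' := by
    rintro _ _ ⟨a, i, hi, rfl⟩ ⟨b, j, hj, rfl⟩
    exact ⟨a + b, i + j, add_mem hi hj, by rw [map_add]; ring⟩
  zero_mem' := ⟨0, 0, zero_mem _, by simp⟩
  neg_mem' := by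
    rintro _ ⟨a, i, hi, rfl⟩
    exact ⟨-a, -i, neg_mem hi, by rw [map_neg]; ring⟩

/-!
Since `X ^ n - X = X * (X ^ (n - 1) - 1)` with coprime factors, evaluation at `0` and reduction
modulo `X ^ (n - 1) - 1` identify `K[X] / (X ^ n - X)` with `K × T`, where
`T = K[X] / (X ^ (n - 1) - 1)`, and `I` with the factor `T`. Hence `D + I` is isomorphic to `D × T`
(`subringDI.bijective_constantTerm_prod`). The ring `T` is Noetherian, and it is flat over `D`
because it is a vector space over the fraction field `K`.

For such a product `R` of `D` and a Noetherian flat `D`-algebra `T`, perfectness passes between `R`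
and `D` (`isNDPerfectRing_iff_of_ringEquiv_prod`) because being `m`-presented, flat dimension at
most `d` and projective dimension at most `d` are all stable under flat base change. An `R`-module
`M` is the sum of `D ⊗ M` and `T ⊗ M`; the first is controlled by perfectness of `D`, the second by
the fact that over a Noetherian ring a finite module of flat dimension at most `d` has projective
dimension at most `d` (`IteratedFlatDimensionLE.hasProjectiveDimensionLE`). Conversely a `D`-module
`N` is recovered as `D ⊗ (R ⊗ N)`, and `D → R` is flat, so perfectness of `R` applies to `R ⊗ N`.
-/

/-! ### Flat base change of presentations and resolutions -/

section BaseChange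

open TensorProduct Module

variable {R : Type u} [CommRing R] (A : Type u) [CommRing A] [Algebra R A]

theorem LinearMap.exact_baseChange_of_flat [Flat R A] {M N P : Type*} [AddCommGroup M]
    [AddCommGroup N] [AddCommGroup P] [Module R M] [Module R N] [Module R P]
    {f : M →ₗ[R] N} {g : N →ₗ[R] P} (h : Function.Exact f g) :
    Function.Exact (f.baseChange A) (g.baseChange A) :=
  Flat.lTensor_exact A h

theorem LinearMap.surjective_baseChange {M N : Type*} [AddCommGroup M] [AddCommGroup N]
    [Module R M] [Module R N] {f : M →ₗ[R] N} (h : Function.Surjective f) :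
    Function.Surjective (f.baseChange A) :=
  LinearMap.lTensor_surjective A h

theorem LinearMap.injective_baseChange_of_flat [Flat R A] {M N : Type*} [AddCommGroup M]
    [AddCommGroup N] [Module R M] [Module R N] {f : M →ₗ[R] N} (h : Function.Injective f) :
    Function.Injective (f.baseChange A) :=
  Flat.lTensor_preserves_injective_linearMap f h

variable {M : Type u} [AddCommGroup M] [Module R M]

theorem IsNPresented.finite {n : ℕ} (h : IsNPresented n R M) : Module.Finite R M := by
  obtain ⟨r, f, ε, hε, -⟩ := h
  exact Module.Finite.of_surjective ε hε

theorem IsNPresented.baseChange [Flat R A] {n : ℕ} (h : IsNPresented n R M) :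
    IsNPresented n A (A ⊗[R] M) := by
  obtain ⟨r, f, ε, hε, h0, hs⟩ := h
  let E (k : ℕ) : A ⊗[R] (Fin k → R) ≃ₗ[A] (Fin k → A) := TensorProduct.piScalarRight R A A (Fin k)
  refine ⟨r, fun i ↦ (E (r i)).toLinearMap ∘ₗ (f i).baseChange A ∘ₗ (E (r (i + 1))).symm.toLinearMap,
    ε.baseChange A ∘ₗ (E (r 0)).symm.toLinearMap, ?_, fun hn ↦ ?_, fun i hi ↦ ?_⟩
  · exact (LinearMap.surjective_baseChange A hε).comp (E (r 0)).symm.surjective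
  · refine (Function.Exact.iff_of_ladder_linearEquiv (e₁ := E (r 1)) (e₂ := E (r 0))
      (e₃ := LinearEquiv.refl A _) ?_ ?_).mpr (LinearMap.exact_baseChange_of_flat A (h0 hn)) <;>
    · ext; simp
  · refine (Function.Exact.iff_of_ladder_linearEquiv (e₁ := E (r (i + 1 + 1)))
      (e₂ := E (r (i + 1))) (e₃ := E (r i)) ?_ ?_).mpr
        (LinearMap.exact_baseChange_of_flat A (hs i hi)) <;>
    · ext; simp

theorem HasFlatDimensionLE.baseChange [Flat R A] {d : ℕ} (h : HasFlatDimensionLE d R M) :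
    HasFlatDimensionLE d A (A ⊗[R] M) := by
  obtain ⟨F, f, ε, hF, hd, hε, h0, hs⟩ := h
  refine ⟨fun i ↦ ModuleCat.of A (A ⊗[R] F i), fun i ↦ (f i).baseChange A, ε.baseChange A,
    fun i ↦ ?_, fun i hi ↦ ?_, LinearMap.surjective_baseChange A hε,
    LinearMap.exact_baseChange_of_flat A h0, fun i ↦ LinearMap.exact_baseChange_of_flat A (hs i)⟩
  · have := hF i
    exact Flat.baseChange R A (F i)
  · have := hd i hi
    exact inferInstanceAs (Subsingleton (A ⊗[R] F i))

end BaseChange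

/-! ### Projective dimension -/

section ProjectiveDimension

open TensorProduct Module CategoryTheory

variable {R : Type u} [CommRing R]

theorem hasProjectiveDimensionLE_zero_iff {M : Type u} [AddCommGroup M] [Module R M] :
    HasProjectiveDimensionLE (ModuleCat.of R M) 0 ↔ Module.Projective R M := by
  rw [← projective_iff_hasProjectiveDimensionLE_zero, IsProjective.iff_projective]

theorem hasProjectiveDimensionLE_succ_iff {L P M : Type u} [AddCommGroup L] [AddCommGroup P]
    [AddCommGroup M] [Module R L] [Module R P] [Module R M] [Module.Projective R P]
    {i : L →ₗ[R] P} {p : P →ₗ[R] M} (hi : Function.Injective i) (hip : Function.Exact i p)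
    (hp : Function.Surjective p) (d : ℕ) :
    HasProjectiveDimensionLE (ModuleCat.of R M) (d + 1) ↔
      HasProjectiveDimensionLE (ModuleCat.of R L) d := by
  have hS := ModuleCat.shortComplex_shortExact
    (ShortComplex.mk (ModuleCat.ofHom i) (ModuleCat.ofHom p)
      (by ext x; exact hip.apply_apply_eq_zero x)) hip hi hp
  exact hS.hasProjectiveDimensionLT_X₃_iff d
    (ModuleCat.projective_of_categoryTheory_projective (ModuleCat.of R P))

theorem exists_projective_surjective (R : Type u) [CommRing R] (M : Type u) [AddCommGroup M]
    [Module R M] :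
    ∃ (P : ModuleCat.{u} R) (p : P →ₗ[R] M), Module.Projective R P ∧ Function.Surjective p :=
  ⟨ModuleCat.of R (M →₀ R), Finsupp.linearCombination R id,
    (inferInstance : Module.Projective R (M →₀ R)), Finsupp.linearCombination_id_surjective R M⟩

theorem hasProjectiveDimensionLE_baseChange (A : Type u) [CommRing A] [Algebra R A] [Flat R A]
    (d : ℕ) : ∀ (M : Type u) [AddCommGroup M] [Module R M],
      HasProjectiveDimensionLE (ModuleCat.of R M) d →
        HasProjectiveDimensionLE (ModuleCat.of A (A ⊗[R] M)) d := by
  induction d with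
  | zero =>
    intro M _ _ h
    rw [hasProjectiveDimensionLE_zero_iff] at h ⊢
    infer_instance
  | succ d ih =>
    intro M _ _ h
    obtain ⟨P, p, _, hp⟩ := exists_projective_surjective R M
    have hi := Subtype.val_injective (p := (· ∈ LinearMap.ker p))
    have he := LinearMap.exact_subtype_ker_map p
    refine (hasProjectiveDimensionLE_succ_iff (i := (LinearMap.ker p).subtype.baseChange A)
      (p := p.baseChange A) (LinearMap.injective_baseChange_of_flat A hi)
      (LinearMap.exact_baseChange_of_flat A he) (LinearMap.surjective_baseChange A hp) d).mpr ?_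
    exact ih _ ((hasProjectiveDimensionLE_succ_iff hi he hp d).mp h)

/-- Restriction of scalars along `R → A` preserves projectivity when `A` is `R`-projective. -/
theorem Module.Projective.restrictScalars_of_projective (A : Type u) [CommRing A] [Algebra R A]
    [Module.Projective R A] (M : Type u) [AddCommGroup M] [Module R M] [Module A M]
    [IsScalarTower R A M] [Module.Projective A M] : Module.Projective R M := by
  classical
  obtain ⟨s, hs⟩ := Module.projective_def'.mp ‹Module.Projective A M›
  have : Module.Projective R (M →₀ A) := .of_equiv (finsuppLequivDFinsupp R).symm
  refine .of_split (s.restrictScalars R) ((Finsupp.linearCombination A id).restrictScalars R) ?_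
  ext x
  exact LinearMap.congr_fun hs x

/-- If `R` is the product of its algebras `A` and `B`, projective dimension at most `d` can be
checked after base change to `A` and to `B`. -/
theorem hasProjectiveDimensionLE_of_linearEquiv_prod {A B : Type u} [CommRing A] [CommRing B]
    [Algebra R A] [Algebra R B] [Module.Projective R A] [Module.Projective R B]
    (e : R ≃ₗ[R] A × B) (d : ℕ) :
    ∀ (M : Type u) [AddCommGroup M] [Module R M],
      HasProjectiveDimensionLE (ModuleCat.of A (A ⊗[R] M)) d →
      HasProjectiveDimensionLE (ModuleCat.of B (B ⊗[R] M)) d →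
        HasProjectiveDimensionLE (ModuleCat.of R M) d := by
  induction d with
  | zero =>
    intro M _ _ hA hB
    rw [hasProjectiveDimensionLE_zero_iff] at hA hB ⊢
    have := Module.Projective.restrictScalars_of_projective (R := R) A (A ⊗[R] M)
    have := Module.Projective.restrictScalars_of_projective (R := R) B (B ⊗[R] M)
    exact .of_equiv ((TensorProduct.lid R M).symm ≪≫ₗ TensorProduct.congr e (LinearEquiv.refl R M)
      ≪≫ₗ TensorProduct.prodLeft R R A B M).symm
  | succ d ih =>
    intro M _ _ hA hB
    obtain ⟨P, p, _, hp⟩ := exists_projective_surjective R M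
    have hi := Subtype.val_injective (p := (· ∈ LinearMap.ker p))
    have he := LinearMap.exact_subtype_ker_map p
    have key (C : Type u) [CommRing C] [Algebra R C] [Flat R C] :=
      hasProjectiveDimensionLE_succ_iff (i := (LinearMap.ker p).subtype.baseChange C)
        (p := p.baseChange C) (LinearMap.injective_baseChange_of_flat C hi)
        (LinearMap.exact_baseChange_of_flat C he) (LinearMap.surjective_baseChange C hp) d
    exact (hasProjectiveDimensionLE_succ_iff hi he hp d).mpr
      (ih _ ((key A).mp hA) ((key B).mp hB))

end ProjectiveDimension

/-! ### Flat dimension of finite modules over Noetherian rings -/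

section FlatDimension

open TensorProduct Module CategoryTheory

variable {R : Type u} [CommRing R]

theorem Module.Flat.prod (N P : Type u) [AddCommGroup N] [AddCommGroup P] [Module R N] [Module R P]
    [Flat R N] [Flat R P] : Flat R (N × P) := by
  refine Flat.iff_rTensor_injective'.mpr fun I ↦ ?_
  have h : (TensorProduct.prodRight R R R N P).toLinearMap ∘ₗ I.subtype.rTensor (N × P) =
      (I.subtype.rTensor N).prodMap (I.subtype.rTensor P) ∘ₗ
        (TensorProduct.prodRight R R I N P).toLinearMap := by
    ext <;> simp
  refine .of_comp (f := TensorProduct.prodRight R R R N P) ?_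
  have h' : TensorProduct.prodRight R R R N P ∘ I.subtype.rTensor (N × P) =
      (I.subtype.rTensor N).prodMap (I.subtype.rTensor P) ∘ TensorProduct.prodRight R R I N P :=
    congrArg DFunLike.coe h
  rw [h']
  exact ((Flat.rTensor_preserves_injective_linearMap _ Subtype.val_injective).prodMap
    (Flat.rTensor_preserves_injective_linearMap _ Subtype.val_injective)).comp
      (TensorProduct.prodRight R R I N P).injective

/-- The kernel of a surjection of flat modules is flat. -/
theorem Module.Flat.of_exact {L F G : Type u} [AddCommGroup L] [AddCommGroup F]
    [AddCommGroup G] [Module R L] [Module R F] [Module R G] [Flat R F] [Flat R G]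
    {i : L →ₗ[R] F} {p : F →ₗ[R] G} (hi : Function.Injective i) (hip : Function.Exact i p)
    (hp : Function.Surjective p) : Flat R L := by
  refine Flat.iff_rTensor_injective'.mpr fun I ↦ .of_comp (f := i.lTensor R) ?_
  rw [← LinearMap.coe_comp, LinearMap.lTensor_comp_rTensor, ← LinearMap.rTensor_comp_lTensor,
    LinearMap.coe_comp]
  exact (Flat.rTensor_preserves_injective_linearMap _ Subtype.val_injective).comp
    (LinearMap.lTensor_injective_of_exact_of_flat p hp i hi hip I)

/-- Flat dimension at most `d`, by recursion on `d`: a flat module for `d = 0`, and a quotient of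
a flat module by a submodule of flat dimension at most `d` for `d + 1`. -/
def IteratedFlatDimensionLE (R : Type u) [CommRing R] :
    ℕ → ∀ (M : Type u) [AddCommGroup M] [Module R M], Prop
  | 0, M, _, _ => Flat R M
  | d + 1, M, _, _ => ∃ (L F : ModuleCat.{u} R) (i : L →ₗ[R] F) (p : F →ₗ[R] M), Flat R F ∧
      Function.Injective i ∧ Function.Exact i p ∧ Function.Surjective p ∧
        IteratedFlatDimensionLE R d L

theorem HasFlatDimensionLE.iteratedFlatDimensionLE (d : ℕ) :
    ∀ (M : Type u) [AddCommGroup M] [Module R M], HasFlatDimensionLE d R M →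
      IteratedFlatDimensionLE R d M := by
  induction d with
  | zero =>
    rintro M _ _ ⟨F, f, ε, hF, hd, hε, h0, -⟩
    have := hF 0
    have := hd 1 one_pos
    refine Flat.of_linearEquiv (LinearEquiv.ofBijective ε ⟨?_, hε⟩).symm
    refine (injective_iff_map_eq_zero ε).mpr fun x hx ↦ ?_
    obtain ⟨y, rfl⟩ := (h0 x).mp hx
    rw [Subsingleton.elim y 0, map_zero]
  | succ d ih =>
    rintro M _ _ ⟨F, f, ε, hF, hd, hε, h0, hs⟩
    refine ⟨ModuleCat.of R (LinearMap.ker ε), F 0, (LinearMap.ker ε).subtype, ε, hF 0,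
      Subtype.val_injective, LinearMap.exact_subtype_ker_map ε, hε, ih _ ?_⟩
    refine ⟨fun i ↦ F (i + 1), fun i ↦ f (i + 1),
      (f 0).codRestrict (LinearMap.ker ε) fun x ↦ h0.apply_apply_eq_zero x, fun i ↦ hF (i + 1),
      fun i hi ↦ hd (i + 1) (by omega), ?_, ?_, fun i ↦ hs (i + 1)⟩
    · rintro ⟨x, hx⟩
      obtain ⟨y, rfl⟩ := (h0 x).mp hx
      exact ⟨y, rfl⟩
    · intro x
      rw [← hs 0 x, Subtype.ext_iff]
      rfl

/-- The kernel of a surjection from a module of flat dimension at most `d` onto a flat module has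
flat dimension at most `d`. -/
theorem IteratedFlatDimensionLE.of_exact {d : ℕ} {L N G : Type u} [AddCommGroup L]
    [AddCommGroup N] [AddCommGroup G] [Module R L] [Module R N] [Module R G] [Flat R G]
    (hN : IteratedFlatDimensionLE R d N) {i : L →ₗ[R] N} {p : N →ₗ[R] G}
    (hi : Function.Injective i) (hip : Function.Exact i p) (hp : Function.Surjective p) :
    IteratedFlatDimensionLE R d L := by
  cases d with
  | zero =>
    have : Flat R N := hN
    exact Flat.of_exact hi hip hp
  | succ d =>
    obtain ⟨B, F, j, q, _, hj, hjq, hq, hB⟩ := hN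
    -- The kernel `K` of `F → N → G` is flat and maps onto `L`, with kernel `B`.
    let K := LinearMap.ker (p ∘ₗ q)
    have hK : Flat R K := Flat.of_exact (i := K.subtype) (p := p ∘ₗ q) Subtype.val_injective
      (LinearMap.exact_subtype_ker_map _) (hp.comp hq)
    let eL := LinearEquiv.ofInjective i hi
    have hmem (x : K) : q x ∈ LinearMap.range i := (hip (q x)).mp x.2
    let π : K →ₗ[R] L := eL.symm.toLinearMap ∘ₗ (q ∘ₗ K.subtype).codRestrict _ hmem
    have hπ (x : K) : i (π x) = q x :=
      congrArg Subtype.val (eL.apply_symm_apply ⟨q x, hmem x⟩)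
    refine ⟨B, ModuleCat.of R K, j.codRestrict K fun b ↦ ?_, π, hK, fun a b h ↦ ?_, fun x ↦ ?_,
      fun l ↦ ?_, hB⟩
    · simp [K, hjq.apply_apply_eq_zero]
    · exact hj (congrArg Subtype.val h)
    · rw [← map_eq_zero_iff i hi, hπ, hjq x.1]
      exact ⟨fun ⟨b, hb⟩ ↦ ⟨b, Subtype.ext hb⟩, fun ⟨b, hb⟩ ↦ ⟨b, congrArg Subtype.val hb⟩⟩
    · obtain ⟨y, hy⟩ := hq (i l)
      refine ⟨⟨y, by simp [K, hy, hip.apply_apply_eq_zero]⟩, hi ?_⟩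
      rw [hπ, hy]

theorem IteratedFlatDimensionLE.prod {d : ℕ} {N P : Type u} [AddCommGroup N] [AddCommGroup P]
    [Module R N] [Module R P] [Flat R P] (hN : IteratedFlatDimensionLE R d N) :
    IteratedFlatDimensionLE R d (N × P) := by
  cases d with
  | zero =>
    have : Flat R N := hN
    exact Flat.prod N P
  | succ d =>
    obtain ⟨B, F, j, q, _, hj, hjq, hq, hB⟩ := hN
    refine ⟨B, ModuleCat.of R (F × P), LinearMap.inl R F P ∘ₗ j, q.prodMap LinearMap.id,
      Flat.prod F P, LinearMap.inl_injective.comp hj, fun x ↦ ?_,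
      hq.prodMap Function.surjective_id, hB⟩
    obtain ⟨x, y⟩ := x
    have := hjq x
    aesop

/-- The kernel of any surjection from a projective module onto a module of flat dimension at most
`d + 1` has flat dimension at most `d`: compare with a given flat cover through the pullback. -/
theorem IteratedFlatDimensionLE.of_exact_of_projective {d : ℕ} {L P M : Type u} [AddCommGroup L]
    [AddCommGroup P] [AddCommGroup M] [Module R L] [Module R P] [Module R M]
    [Module.Projective R P] (hM : IteratedFlatDimensionLE R (d + 1) M) {i : L →ₗ[R] P}
    {p : P →ₗ[R] M} (hi : Function.Injective i) (hip : Function.Exact i p)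
    (hp : Function.Surjective p) : IteratedFlatDimensionLE R d L := by
  obtain ⟨B, F, j, q, _, hj, hjq, hq, hB⟩ := hM
  obtain ⟨s, hs⟩ := Module.projective_lifting_property q p hq
  have hs (x : P) : q (s x) = p x := LinearMap.congr_fun hs x
  -- `(b, x) ↦ j b + s x` maps `B × P` onto `F`; its kernel is `L`, embedded by `l ↦ (β l, i l)`
  -- with `j (β l) = -s (i l)`.
  let eB := LinearEquiv.ofInjective j hj
  have hmem (l : L) : (-(s ∘ₗ i)) l ∈ LinearMap.range j :=
    (hjq _).mp (by simp [hs, hip.apply_apply_eq_zero])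
  let β : L →ₗ[R] B := eB.symm.toLinearMap ∘ₗ (-(s ∘ₗ i)).codRestrict _ hmem
  have hβ (l : L) : j (β l) = -s (i l) :=
    congrArg Subtype.val (eB.apply_symm_apply ⟨(-(s ∘ₗ i)) l, hmem l⟩)
  refine (hB.prod (P := P)).of_exact (i := β.prod i) (p := j.coprod s)
    (fun a b h ↦ hi (congrArg Prod.snd h)) ?_ fun y ↦ ?_
  · rintro ⟨b, x⟩
    constructor
    · intro h
      have hb : j b = -s x := eq_neg_of_add_eq_zero_left h
      obtain ⟨l, rfl⟩ := (hip x).mp (by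
        rw [← hs, ← neg_eq_zero, ← map_neg, ← hb, hjq.apply_apply_eq_zero])
      exact ⟨l, Prod.ext (hj ((hβ l).trans hb.symm)) rfl⟩
    · rintro ⟨l, h⟩
      obtain ⟨rfl, rfl⟩ := Prod.ext_iff.mp h
      simp [hβ]
  · obtain ⟨x, hx⟩ := hp (q y)
    obtain ⟨b, hb⟩ := (hjq (y - s x)).mp (by rw [map_sub, hs, hx, sub_self])
    exact ⟨(b, x), by simp [hb]⟩

/-- Over a Noetherian ring, a finite module of flat dimension at most `d` has projective dimension
at most `d`: its syzygies are finite, and finite flat modules are projective. -/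
theorem IteratedFlatDimensionLE.hasProjectiveDimensionLE [IsNoetherianRing R] (d : ℕ) :
    ∀ (M : Type u) [AddCommGroup M] [Module R M] [Module.Finite R M],
      IteratedFlatDimensionLE R d M → HasProjectiveDimensionLE (ModuleCat.of R M) d := by
  induction d with
  | zero =>
    intro M _ _ _ h
    have : Flat R M := h
    have := Module.finitePresentation_of_finite R M
    exact hasProjectiveDimensionLE_zero_iff.mpr Flat.projective_of_finitePresentation
  | succ d ih =>
    intro M _ _ _ h
    obtain ⟨k, p, hp⟩ := Module.Finite.exists_fin' R M
    have hi := Subtype.val_injective (p := (· ∈ LinearMap.ker p))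
    have he := LinearMap.exact_subtype_ker_map p
    exact (hasProjectiveDimensionLE_succ_iff hi he hp d).mpr
      (ih _ (h.of_exact_of_projective (i := (LinearMap.ker p).subtype) hi he hp))

end FlatDimension

/-! ### Perfectness of a product ring -/

section Product

open TensorProduct Module CategoryTheory

/-- If `R` is the product of `D` and a Noetherian flat `D`-algebra `T`, then `R` is
`(m, d)`-perfect if and only if `D` is. Both projections of `R` are flat, and so is the structure
map `D → R`, which is a section of the first projection. -/
theorem isNDPerfectRing_iff_of_ringEquiv_prod {R D T : Type u} [CommRing R] [CommRing D]
    [CommRing T] [Algebra D T] [Flat D T] [IsNoetherianRing T] (e : R ≃+* D × T) (m d : ℕ) :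
    IsNDPerfectRing m d R ↔ IsNDPerfectRing m d D := by
  let _ : Algebra R D := ((RingHom.fst D T).comp e.toRingHom).toAlgebra
  let _ : Algebra R T := ((RingHom.snd D T).comp e.toRingHom).toAlgebra
  let _ : Algebra D R := (e.symm.toRingHom.comp (algebraMap D (D × T))).toAlgebra
  have hD (r : R) : algebraMap R D r = (e r).1 := rfl
  have hR (a : D) : e (algebraMap D R a) = algebraMap D (D × T) a := e.apply_symm_apply _
  have : IsScalarTower D R D := .of_algebraMap_eq fun a ↦ by rw [hD, hR]; rfl
  let eR : R ≃ₗ[R] D × T :=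
    { e with
      map_smul' := fun r x ↦ by
        refine (map_mul e r x).trans (Prod.ext ?_ ?_)
        · exact (Algebra.smul_def r (e x).1).symm
        · exact (Algebra.smul_def r (e x).2).symm }
  let eD : R ≃ₗ[D] D × T :=
    { e with
      map_smul' := fun a x ↦ by
        rw [Algebra.smul_def]
        exact (map_mul e _ x).trans (by rw [hR, ← Algebra.smul_def]; rfl) }
  have := Flat.prod (R := D) D T
  have : Flat D R := .of_linearEquiv eD
  have : Module.Projective R (D × T) := .of_equiv eR
  have : Module.Projective R D :=
    .of_split (LinearMap.inl R D T) (LinearMap.fst R D T) (by ext; simp)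
  have : Module.Projective R T :=
    .of_split (LinearMap.inr R D T) (LinearMap.snd R D T) (by ext; simp)
  constructor
  · intro h N _ _ hN hfd
    have := hasProjectiveDimensionLE_baseChange D d _
      (h (R ⊗[D] N) (hN.baseChange R) (hfd.baseChange R))
    exact ModuleCat.hasProjectiveDimensionLE_of_linearEquiv
      (M := ModuleCat.of D (D ⊗[R] (R ⊗[D] N))) (N := ModuleCat.of D N)
      (AlgebraTensorModule.cancelBaseChange D R D D N ≪≫ₗ TensorProduct.lid D N) d
  · intro h M _ _ hM hfd
    have := hM.finite
    exact hasProjectiveDimensionLE_of_linearEquiv_prod eR d M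
      (h _ (hM.baseChange D) (hfd.baseChange D))
      (((hfd.baseChange T).iteratedFlatDimensionLE).hasProjectiveDimensionLE)

end Product

/-! ### The decomposition of `D + I` -/

section Decomposition

variable {n : ℕ} {D K : Type u} [CommRing D] [Field K] [Algebra D K]

/-- The complementary factor `K[X] / (X ^ (n - 1) - 1)` of `K` in `K[X] / (X ^ n - X)`. -/
abbrev RootsOfUnityQuot (n : ℕ) (K : Type u) [Field K] : Type u :=
  K[X] ⧸ Ideal.span {(X ^ (n - 1) - 1 : K[X])}

theorem X_pow_sub_X_eq_mul (hn : n ≠ 0) : (X ^ n - X : K[X]) = X * (X ^ (n - 1) - 1) := by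
  rw [mul_sub, mul_pow_sub_one hn, mul_one]

/-- Evaluation at `0` on `K[X] / (X ^ n - X)`. -/
noncomputable def QuotRing.evalZero (K : Type u) [Field K] (hn : n ≠ 0) : QuotRing n K →+* K :=
  Ideal.Quotient.lift _ (evalRingHom 0) fun p hp ↦ by
    obtain ⟨q, rfl⟩ := Ideal.mem_span_singleton.mp hp
    simp [hn]

/-- Reduction modulo `X ^ (n - 1) - 1` on `K[X] / (X ^ n - X)`. -/
noncomputable def QuotRing.toRootsOfUnityQuot (K : Type u) [Field K] (hn : n ≠ 0) :
    QuotRing n K →+* RootsOfUnityQuot n K :=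
  Ideal.Quotient.factor (Ideal.span_singleton_le_span_singleton.mpr
    ⟨X, by rw [X_pow_sub_X_eq_mul hn, mul_comm]⟩)

theorem QuotRing.eq_zero_of_evalZero_eq_zero (hn : 2 ≤ n) {s : QuotRing n K}
    (h₀ : QuotRing.evalZero K (by omega) s = 0)
    (h₁ : QuotRing.toRootsOfUnityQuot K (by omega) s = 0) : s = 0 := by
  obtain ⟨p, rfl⟩ := Ideal.Quotient.mk_surjective s
  have hX : X ∣ p := by
    rw [X_dvd_iff, coeff_zero_eq_eval_zero]
    exact h₀
  have hU : (X ^ (n - 1) - 1) ∣ p :=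
    Ideal.mem_span_singleton.mp (Ideal.Quotient.eq_zero_iff_mem.mp h₁)
  have hc : IsCoprime (X : K[X]) (X ^ (n - 1) - 1) := by
    refine ⟨X ^ (n - 2), -1, ?_⟩
    rw [← pow_succ, show n - 2 + 1 = n - 1 by omega]
    ring
  rw [Ideal.Quotient.eq_zero_iff_mem, Ideal.mem_span_singleton, X_pow_sub_X_eq_mul (by omega)]
  exact hc.mul_dvd hX hU

theorem evalZero_baseMap (hn : n ≠ 0) (a : D) :
    QuotRing.evalZero K hn (baseMap n D K a) = algebraMap D K a :=
  eval_C

theorem evalZero_eq_zero_of_mem_idealX (hn : n ≠ 0) {i : QuotRing n K} (hi : i ∈ idealX n K) :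
    QuotRing.evalZero K hn i = 0 := by
  obtain ⟨q, rfl⟩ := Ideal.mem_span_singleton.mp hi
  rw [map_mul]
  exact mul_eq_zero_of_left eval_X _

/-- The isomorphism of `D` with its image in `K`. -/
noncomputable def algebraMapRangeEquiv (D K : Type u) [CommRing D] [Field K] [Algebra D K]
    [FaithfulSMul D K] : D ≃+* (algebraMap D K).range :=
  RingEquiv.ofBijective (algebraMap D K).rangeRestrict
    ⟨fun _ _ h ↦ FaithfulSMul.algebraMap_injective D K (congrArg Subtype.val h),
      (algebraMap D K).rangeRestrict_surjective⟩

/-- The projection `D + I → D`, obtained by evaluating at `0`. It is well defined because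
evaluation at `0` takes values in the image of `D`, which is isomorphic to `D`. -/
noncomputable def subringDI.constantTerm [FaithfulSMul D K] (hn : n ≠ 0) :
    subringDI n D K →+* D :=
  (algebraMapRangeEquiv D K).symm.toRingHom.comp
    (((QuotRing.evalZero K hn).comp (subringDI n D K).subtype).codRestrict (algebraMap D K).range
      fun ⟨_, a, i, hi, hs⟩ ↦ ⟨a, by
        simp [hs, evalZero_baseMap, evalZero_eq_zero_of_mem_idealX hn hi]⟩)

theorem subringDI.algebraMap_constantTerm [FaithfulSMul D K] (hn : n ≠ 0)
    (s : subringDI n D K) :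
    algebraMap D K (subringDI.constantTerm hn s) = QuotRing.evalZero K hn s :=
  congrArg Subtype.val ((algebraMapRangeEquiv D K).apply_symm_apply _)

theorem subringDI.bijective_constantTerm_prod [FaithfulSMul D K] (hn : 2 ≤ n) :
    Function.Bijective ((subringDI.constantTerm (n := n) (D := D) (K := K) (by omega)).prod
      ((QuotRing.toRootsOfUnityQuot K (by omega)).comp (subringDI n D K).subtype)) := by
  constructor
  · refine (injective_iff_map_eq_zero _).mpr fun s hs ↦ ?_
    obtain ⟨h₀, h₁⟩ := Prod.ext_iff.mp hs
    refine Subtype.ext (QuotRing.eq_zero_of_evalZero_eq_zero hn ?_ h₁)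
    rw [← subringDI.algebraMap_constantTerm (D := D)]
    exact (congrArg _ h₀).trans (map_zero _)
  · rintro ⟨a, t⟩
    obtain ⟨q, rfl⟩ := Ideal.Quotient.mk_surjective t
    -- `a + X ^ (n - 1) * (q - a)` takes the value `a` at `0` and is congruent to `q`
    -- modulo `X ^ (n - 1) - 1`.
    let c : K[X] := C (algebraMap D K a)
    refine ⟨⟨baseMap n D K a + Ideal.Quotient.mk _ (X ^ (n - 1) * (q - c)), a, _, ?_, rfl⟩,
      Prod.ext ?_ ?_⟩
    · refine Ideal.mem_span_singleton.mpr (map_dvd _ ?_)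
      exact (dvd_pow_self X (by omega)).mul_right _
    · refine FaithfulSMul.algebraMap_injective D K
        ((subringDI.algebraMap_constantTerm (by omega) _).trans ?_)
      change eval 0 (c + X ^ (n - 1) * (q - c)) = _
      simp [c, show n - 1 ≠ 0 by omega]
    · change Ideal.Quotient.mk _ (c + X ^ (n - 1) * (q - c)) = Ideal.Quotient.mk _ q
      rw [Ideal.Quotient.mk_eq_mk_iff_sub_mem, Ideal.mem_span_singleton]
      exact ⟨q - c, by ring⟩

end Decomposition

theorem corollary4p4 (D K : Type u) [CommRing D] [IsDomain D] [Field K] [Algebra D K]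
    [IsFractionRing D K] (n m d : ℕ) (hn : 2 ≤ n) :
    IsNDPerfectRing m d (subringDI n D K) ↔ IsNDPerfectRing m d D := by
  have : Module.Flat D K := IsLocalization.flat K (nonZeroDivisors D)
  have : Module.Flat D (RootsOfUnityQuot n K) := Module.Flat.trans D K _
  exact isNDPerfectRing_iff_of_ringEquiv_prod
    (RingEquiv.ofBijective _ (subringDI.bijective_constantTerm_prod hn)) m d
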